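/- All graphs are finite and simple. A planar straight-line drawing of a graph $G$ places its vertices at distinct points of the Euclidean plane and draws its edges as straight-line segments, such that no edge contains a vertex other than its two endpoints and two distinct edges meet at most in a common endpoint. The local edge-length ratio of a drawing is the maximum of $|UV|/|VW|$ over all pairs of edges $UV$, $VW$ of $G$ sharing a vertex $V$ (it is $0$ if $G$ has no edge). The local edge-length ratio $\rho_l(G)$ of $G$ is the infimum of the local edge-length ratios of all planar straight-line drawings of $G$ ($+\infty$ if there is no such drawing). Corollary. Every graph $G$ of treewidth at most $2$ satisfies $\rho_l(G)\le 4$; in particular, it has a planar straight-line drawing. Likewise $\rho_l(G)\le 4$ for every series-parallel graph $G$, that is, every graph obtained from single edges, whose two ends are the terminals, by series and parallel compositions of two-terminal graphs, where parallel edges are merged. -/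

import Mathlib

open scoped ENNReal

namespace SimpleGraph

/-- A tree decomposition of `G` whose tree has node set `ι`. -/
structure TreeDecomposition {V : Type*} (G : SimpleGraph V) (ι : Type*) where
  /-- the tree -/
  tree : SimpleGraph ι
  isTree : tree.IsTree
  /-- the bags -/
  bag : ι → Set V
  exists_mem_bag : ∀ v : V, ∃ i, v ∈ bag i
  exists_adj_mem_bag : ∀ u v : V, G.Adj u v → ∃ i, u ∈ bag i ∧ v ∈ bag i
  preconnected_induce : ∀ v : V, (tree.induce {i | v ∈ bag i}).Preconnected

/-- The width of a tree decomposition: the largest size of a bag, minus one. -/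
noncomputable def TreeDecomposition.width {V ι : Type*} {G : SimpleGraph V}
    (D : G.TreeDecomposition ι) : ℕ∞ :=
  (⨆ i, (D.bag i).encard) - 1

/-- The treewidth of `G`: the least width of a tree decomposition of `G` over a finite tree
(`⊤` if all of them have infinite width). -/
noncomputable def treewidth {V : Type*} (G : SimpleGraph V) : ℕ∞ :=
  ⨅ (ι : Type) (_ : Finite ι) (D : G.TreeDecomposition ι), D.width

/-- `IsTwoTerminalSeriesParallel G H s t`: the subgraph `H` of `G` is a two-terminal
series-parallel graph with terminals `s` and `t`, that is, it is obtained from single edges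
(with their two ends as terminals) by series and parallel compositions. Parallel edges that a
parallel composition may create are merged into one. -/
inductive IsTwoTerminalSeriesParallel {V : Type*} (G : SimpleGraph V) :
    G.Subgraph → V → V → Prop
  | edge {s t : V} (h : G.Adj s t) :
      IsTwoTerminalSeriesParallel G (G.subgraphOfAdj h) s t
  | series {H₁ H₂ : G.Subgraph} {s m t : V}
      (h₁ : IsTwoTerminalSeriesParallel G H₁ s m) (h₂ : IsTwoTerminalSeriesParallel G H₂ m t)
      (h : H₁.verts ∩ H₂.verts = {m}) :
      IsTwoTerminalSeriesParallel G (H₁ ⊔ H₂) s t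
  | parallel {H₁ H₂ : G.Subgraph} {s t : V}
      (h₁ : IsTwoTerminalSeriesParallel G H₁ s t) (h₂ : IsTwoTerminalSeriesParallel G H₂ s t)
      (h : H₁.verts ∩ H₂.verts = {s, t}) :
      IsTwoTerminalSeriesParallel G (H₁ ⊔ H₂) s t

/-- `G` is a series-parallel graph: it is two-terminal series-parallel for some choice of the
two terminals. -/
def IsSeriesParallel {V : Type*} (G : SimpleGraph V) : Prop :=
  ∃ s t : V, IsTwoTerminalSeriesParallel G ⊤ s t

/-- A planar straight-line drawing of `G`: vertices are distinct points of the Euclidean plane,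
the segment of an edge contains no vertex other than its two ends, and the segments of
two distinct edges do not meet in their interiors. -/
structure PlanarStraightLineDrawing {V : Type*} (G : SimpleGraph V) where
  /-- the point that represents a vertex -/
  pos : V → EuclideanSpace ℝ (Fin 2)
  injective_pos : Function.Injective pos
  notMem_segment : ∀ u v w : V, G.Adj u v → w ≠ u → w ≠ v →
    pos w ∉ segment ℝ (pos u) (pos v)
  disjoint_openSegment : ∀ u v x y : V, G.Adj u v → G.Adj x y → s(u, v) ≠ s(x, y) →
    Disjoint (openSegment ℝ (pos u) (pos v)) (openSegment ℝ (pos x) (pos y))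

/-- The local edge-length ratio of a drawing: the maximum of `|UV| / |VW|` over all edges
`UV` and `VW` sharing a vertex (`0` if there are no edges). -/
noncomputable def PlanarStraightLineDrawing.localEdgeLengthRatio {V : Type*}
    {G : SimpleGraph V} (D : G.PlanarStraightLineDrawing) : ℝ≥0∞ :=
  ⨆ (u : V) (v : V) (w : V) (_ : G.Adj u v) (_ : G.Adj v w),
    ENNReal.ofReal (Dist.dist (D.pos u) (D.pos v) / Dist.dist (D.pos v) (D.pos w))

/-- The local edge-length ratio of a graph: the infimum over all its planar straight-line
drawings (`⊤` if there are none). -/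
noncomputable def localEdgeLengthRatio {V : Type*} (G : SimpleGraph V) : ℝ≥0∞ :=
  ⨅ D : G.PlanarStraightLineDrawing, D.localEdgeLengthRatio

end SimpleGraph

/-! Both kinds of graphs are subgraphs of 2-trees, so it suffices to draw every 2-tree with local
ratio at most any `K > 4`. Only horizontal lengths matter: multiplying second coordinates by a small
`c > 0` preserves planarity, and Euclidean lengths tend to horizontal ones as `c → 0`. Each vertex
gets a scale `r`, and its edges are kept at horizontal length in `(r, K * r)`, so two edges at a
vertex have ratio below `K`.

The 2-tree is drawn inductively (`IsExtendableDrawing.step`). Each edge `ab` owns an open triangle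
with apex `c`, disjoint from the rest of the drawing. A new neighbour `x` goes into it, and a point
`z` in `tri a b x` splits off triangles for `ab`, `ax` and `bx`. The invariant `IsExtendable` makes
this repeatable (`exists_subdivision`): an inner edge puts `x` near its midpoint and yields one
outer and one inner edge; an outer edge puts `x` near its apex and yields two inner ones. The length
constraints are open, so they only need checking at limit positions in the closed triangle. The
intervals `(2r, K/2 r)`, `(4s, Ks)` and `(r, K/4 r)` all have end ratio `K/4`, whence the bound 4.
-/

namespace PlaneTriangle

/-! ### Barycentric coordinates and open triangles -/

open Filter Topology

/-- Twice the signed area of a triangle in the plane. -/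
def det (a b c : ℝ × ℝ) : ℝ := (b.1 - a.1) * (c.2 - a.2) - (c.1 - a.1) * (b.2 - a.2)

/-- The open triangle spanned by three points of the plane. -/
def tri (a b c : ℝ × ℝ) : Set (ℝ × ℝ) :=
  {p | ∃ x y z : ℝ, 0 < x ∧ 0 < y ∧ 0 < z ∧ x + y + z = 1 ∧ p = x • a + y • b + z • c}

lemma tri_swap (a b c : ℝ × ℝ) : tri a b c = tri b a c := by
  ext p
  constructor <;> rintro ⟨x, y, z, hx, hy, hz, h, rfl⟩ <;>
    exact ⟨y, x, z, hy, hx, hz, by linarith, by abel⟩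

lemma tri_rotate (a b c : ℝ × ℝ) : tri a b c = tri b c a := by
  ext p
  constructor
  · rintro ⟨x, y, z, hx, hy, hz, h, rfl⟩
    exact ⟨y, z, x, hy, hz, hx, by linarith, by abel⟩
  · rintro ⟨x, y, z, hx, hy, hz, h, rfl⟩
    exact ⟨z, x, y, hz, hx, hy, by linarith, by abel⟩

lemma det_swap (a b c : ℝ × ℝ) : det b a c = -det a b c := by
  simp only [det]; ring

lemma det_rotate (a b c : ℝ × ℝ) : det b c a = det a b c := by
  simp only [det]; ring

lemma det_combo {a b c : ℝ × ℝ} {x y z : ℝ} (h : x + y + z = 1) :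
    det a b (x • a + y • b + z • c) = z * det a b c := by
  obtain rfl : x = 1 - y - z := by linarith
  simp only [det, Prod.fst_add, Prod.snd_add, Prod.smul_fst, Prod.smul_snd, smul_eq_mul]
  ring

/-- Barycentric coordinates with respect to a nondegenerate triangle are unique. -/
lemma bary_unique {a b c : ℝ × ℝ} (hd : det a b c ≠ 0) {x y z x' y' z' : ℝ}
    (h : x + y + z = 1) (h' : x' + y' + z' = 1)
    (e : x • a + y • b + z • c = x' • a + y' • b + z' • c) : x = x' ∧ y = y' ∧ z = z' := by
  have hz : z = z' := by
    have := congrArg (det a b) e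
    rw [det_combo h, det_combo h'] at this
    exact mul_right_cancel₀ hd this
  have hx : x = x' := by
    have e' : y • b + z • c + x • a = y' • b + z' • c + x' • a := by
      rw [add_rotate, add_rotate, e, ← add_rotate, ← add_rotate]
    have := congrArg (det b c) e'
    rw [det_combo (by linarith), det_combo (by linarith), det_rotate] at this
    exact mul_right_cancel₀ hd this
  exact ⟨hx, by linarith, hz⟩

lemma det_ne_zero_of_mem_tri {a b c p : ℝ × ℝ} (hd : det a b c ≠ 0) (hp : p ∈ tri a b c) :
    det a b p ≠ 0 := by
  obtain ⟨x, y, z, -, -, hz, h, rfl⟩ := hp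
  rw [det_combo h]
  exact mul_ne_zero hz.ne' hd

/-- Open properties that hold at a point of the closed triangle hold at a point of the open
triangle. -/
lemma exists_mem_tri {a b c : ℝ × ℝ} {x y z : ℝ} (hx : 0 ≤ x) (hy : 0 ≤ y) (hz : 0 ≤ z)
    (h : x + y + z = 1) {Q : ℝ × ℝ → Prop} (hQ : ∀ᶠ p in 𝓝 (x • a + y • b + z • c), Q p) :
    ∃ p ∈ tri a b c, Q p := by
  -- Move from the given point towards the centroid; every `t` in `(0, 1)` makes all three
  -- coordinates positive.
  let f : ℝ → ℝ × ℝ := fun t =>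
    ((1 - t) * x + t / 3) • a + ((1 - t) * y + t / 3) • b + ((1 - t) * z + t / 3) • c
  have hf : Tendsto f (𝓝[>] 0) (𝓝 (x • a + y • b + z • c)) := by
    have hc : Continuous f := by fun_prop
    have := (hc.tendsto 0).mono_left (nhdsWithin_le_nhds (s := Set.Ioi 0))
    simpa [f] using this
  obtain ⟨t, ht, h0, h1⟩ := ((hf.eventually hQ).and
    (Ioo_mem_nhdsGT (zero_lt_one' ℝ))).exists
  refine ⟨f t, ⟨_, _, _, ?_, ?_, ?_, ?_, rfl⟩, ht⟩
  · have := mul_nonneg (sub_nonneg.2 h1.le) hx; linarith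
  · have := mul_nonneg (sub_nonneg.2 h1.le) hy; linarith
  · have := mul_nonneg (sub_nonneg.2 h1.le) hz; linarith
  · linear_combination (1 - t) * h

lemma tri_subset {a b c p : ℝ × ℝ} (hp : p ∈ tri a b c) : tri a b p ⊆ tri a b c := by
  obtain ⟨x, y, z, hx, hy, hz, h, rfl⟩ := hp
  rintro _ ⟨x', y', z', hx', hy', hz', h', rfl⟩
  refine ⟨x' + z' * x, y' + z' * y, z' * z, by positivity, by positivity, by positivity, ?_, ?_⟩
  · linear_combination h' + z' * h
  · module

lemma openSegment_subset_tri {a b c p : ℝ × ℝ} (hp : p ∈ tri a b c) :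
    openSegment ℝ a p ⊆ tri a b c := by
  obtain ⟨x, y, z, hx, hy, hz, h, rfl⟩ := hp
  rintro _ ⟨s, t, hs, ht, hst, rfl⟩
  refine ⟨s + t * x, t * y, t * z, by positivity, by positivity, by positivity, ?_, ?_⟩
  · linear_combination hst + t * h
  · module

/-- For a common point, let `z₁` and `z₂` be its weights on `p` in the two triangles. Comparing
coordinates at `b` gives `z₁ < z₂`, at `c` the reverse. -/
lemma disjoint_tri_tri {a b c p : ℝ × ℝ} (hd : det a b c ≠ 0) (hp : p ∈ tri a b c) :
    Disjoint (tri a b p) (tri a c p) := by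
  obtain ⟨x, y, z, hx, hy, hz, h, rfl⟩ := hp
  rw [Set.disjoint_left]
  rintro _ ⟨x₁, y₁, z₁, hx₁, hy₁, hz₁, h₁, rfl⟩ ⟨x₂, y₂, z₂, hx₂, hy₂, hz₂, h₂, e⟩
  have e' : (x₁ + z₁ * x) • a + (y₁ + z₁ * y) • b + (z₁ * z) • c =
      (x₂ + z₂ * x) • a + (z₂ * y) • b + (y₂ + z₂ * z) • c := by
    convert e using 1 <;> module
  obtain ⟨-, k₂, k₃⟩ := bary_unique hd (by linear_combination h₁ + z₁ * h)
    (by linear_combination h₂ + z₂ * h) e'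
  have : z₁ < z₂ := by
    by_contra hlt
    nlinarith
  nlinarith

lemma notMem_openSegment_of_det {a b c : ℝ × ℝ} (hd : det a b c ≠ 0) :
    c ∉ openSegment ℝ a c := by
  rintro ⟨s, t, hs, ht, hst, e⟩
  have e' : s • a + (0 : ℝ) • b + t • c = (0 : ℝ) • a + (0 : ℝ) • b + (1 : ℝ) • c := by
    simpa using e
  have := (bary_unique hd (by linarith) (by norm_num) e').1
  linarith

lemma disjoint_openSegment_openSegment {a b c : ℝ × ℝ} (hd : det a b c ≠ 0) :
    Disjoint (openSegment ℝ a c) (openSegment ℝ b c) := by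
  rw [Set.disjoint_left]
  rintro _ ⟨s, t, hs, ht, hst, rfl⟩ ⟨s', t', hs', ht', hst', e⟩
  have e' : s • a + (0 : ℝ) • b + t • c = (0 : ℝ) • a + s' • b + t' • c := by
    simpa using e.symm
  have := (bary_unique hd (by linarith) (by linarith) e').1
  linarith

lemma disjoint_openSegment_tri {a b c : ℝ × ℝ} (hd : det a b c ≠ 0) :
    Disjoint (openSegment ℝ a c) (tri a b c) := by
  rw [Set.disjoint_left]
  rintro _ ⟨s, t, hs, ht, hst, rfl⟩ ⟨x, y, z, hx, hy, hz, h, e⟩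
  have e' : s • a + (0 : ℝ) • b + t • c = x • a + y • b + z • c := by
    simpa using e
  have := (bary_unique hd (by linarith) h e').2.1
  linarith

lemma notMem_tri {a b c : ℝ × ℝ} (hd : det a b c ≠ 0) : c ∉ tri a b c := by
  rintro ⟨x, y, z, hx, hy, hz, h, e⟩
  have e' : (0 : ℝ) • a + (0 : ℝ) • b + (1 : ℝ) • c = x • a + y • b + z • c := by
    simpa using e
  have := (bary_unique hd (by norm_num) h e').1
  linarith

end PlaneTriangle

/-! ### Horizontal lengths, scales and the subdivision of a triangle -/

namespace PlaneTriangle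

open Filter Topology Set

/-- Horizontal distance. -/
def hdist (a b : ℝ × ℝ) : ℝ := |a.1 - b.1|

lemma hdist_comm (a b : ℝ × ℝ) : hdist a b = hdist b a := abs_sub_comm _ _

lemma continuous_hdist (a : ℝ × ℝ) : Continuous (hdist a) := by
  unfold hdist; fun_prop

lemma eventually_hdist {a p : ℝ × ℝ} {l u : ℝ} (h : hdist a p ∈ Ioo l u) :
    ∀ᶠ q in 𝓝 p, hdist a q ∈ Ioo l u :=
  (continuous_hdist a).continuousAt.eventually (Ioo_mem_nhds h.1 h.2)

/-- The horizontal length of the edge `ab` is about `2 * r` and about `4 * s`, where `r` and `s`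
are the scales of `a` and `b`: the new neighbours of this edge go to its middle. -/
def IsInner (K : ℝ) (a b : ℝ × ℝ) (r s : ℝ) : Prop :=
  hdist a b ∈ Ioo (2 * r) (K / 2 * r) ∧ hdist a b ∈ Ioo (4 * s) (K * s)

/-- The horizontal length of the edge `ab` is about `r` and about `4 * s`, where `r` and `s`
are the scales of `a` and `b`: the new neighbours of this edge go near the point `c`, which lies
beyond `b`. -/
def IsOuter (K : ℝ) (a b c : ℝ × ℝ) (r s : ℝ) : Prop :=
  hdist a b ∈ Ioo r (K / 4 * r) ∧ hdist a b ∈ Ioo (4 * s) (K * s) ∧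
    hdist a c ∈ Ioo (2 * r) (K / 2 * r) ∧ hdist b c ∈ Ioo (4 * s) (K * s) ∧
    ∃ t, hdist b c ∈ Ioo (2 * t) (K / 2 * t) ∧ hdist a c ∈ Ioo (4 * t) (K * t)

/-- The edge `ab` with apex `c` can be extended in one of the two ways. -/
def IsExtendable (K : ℝ) (a b c : ℝ × ℝ) (r s : ℝ) : Prop :=
  (IsInner K a b r s ∨ IsOuter K a b c r s) ∨ (IsInner K b a s r ∨ IsOuter K b a c s r)

lemma IsExtendable.symm {K : ℝ} {a b c : ℝ × ℝ} {r s : ℝ} (h : IsExtendable K a b c r s) :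
    IsExtendable K b a c s r := Or.symm h

/-- This is what the final ratio bound uses of the invariant; by symmetry it holds at `b` with scale
`s` too. The scale is positive because the intervals would otherwise be empty. -/
lemma IsExtendable.mem_Ioo {K : ℝ} (hK : 4 < K) {a b c : ℝ × ℝ} {r s : ℝ}
    (h : IsExtendable K a b c r s) : hdist a b ∈ Ioo r (K * r) := by
  rcases h with (⟨⟨h₁, h₂⟩, -⟩ | ⟨⟨h₁, h₂⟩, -⟩) | (⟨-, h₁, h₂⟩ | ⟨-, ⟨h₁, h₂⟩, -⟩)
  · have : 0 < r := by
      by_contra! hr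
      nlinarith
    exact ⟨by linarith, by nlinarith⟩
  · have : 0 < r := by
      by_contra! hr
      nlinarith
    exact ⟨by linarith, by nlinarith⟩
  all_goals
    rw [hdist_comm] at h₁ h₂
    have : 0 < r := by
      by_contra! hr
      nlinarith
    exact ⟨by linarith, h₂⟩

lemma exists_subdivision_of_isInner {K : ℝ} (hK : 4 < K) {a b c : ℝ × ℝ} {r s : ℝ}
    (h : IsInner K a b r s) :
    ∃ x ∈ tri a b c, ∃ z ∈ tri a b x, ∃ t, IsExtendable K a b z r s ∧
      IsExtendable K a x z r t ∧ IsExtendable K b x z s t := by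
  obtain ⟨⟨h₁, h₂⟩, h₃, h₄⟩ := id h
  have hr : 0 < r := by
    by_contra! hr
    nlinarith
  have hd : 0 < hdist a b := by linarith
  -- With `L = hdist a b`, this says that `L / 2`, the limit length of both new edges, lies in `(4t,
  -- Kt)`; `t` becomes the scale of `x`.
  obtain ⟨t, ht⟩ : ∃ t, t ∈ Ioo (hdist a b / (2 * K)) (hdist a b / 8) := by
    refine exists_between ?_
    gcongr
    linarith
  -- `u` is the scale of a future vertex near `z` on the outer edge `ax`: `L / 2` lies in `(2u, K/2
  -- u)` and `L` in `(4u, Ku)`.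
  obtain ⟨u, hu⟩ : ∃ u, u ∈ Ioo (hdist a b / K) (hdist a b / 4) := by
    refine exists_between ?_
    gcongr
  have hK0 : 0 < K := by linarith
  have ht1 := (div_lt_iff₀ (by positivity)).1 ht.1
  have hu1 := (div_lt_iff₀ (by positivity)).1 hu.1
  have ht2 := ht.2
  have hu2 := hu.2
  have mid : ∀ p q : ℝ × ℝ, hdist p ((2⁻¹ : ℝ) • p + (2⁻¹ : ℝ) • q + (0 : ℝ) • c) =
      hdist p q / 2 := by
    intro p q
    simp only [hdist, Prod.fst_add, Prod.smul_fst, smul_eq_mul]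
    rw [show p.1 - (2⁻¹ * p.1 + 2⁻¹ * q.1 + 0 * c.1) = (p.1 - q.1) / 2 by ring, abs_div]
    norm_num
  have ma := mid a b
  have mb := mid b a
  rw [add_comm ((2⁻¹ : ℝ) • b), hdist_comm b a] at mb
  have ev : ∀ᶠ p in 𝓝 ((2⁻¹ : ℝ) • a + (2⁻¹ : ℝ) • b + (0 : ℝ) • c),
      hdist a p ∈ Ioo r (K / 4 * r) ∧ hdist a p ∈ Ioo (4 * t) (K * t) ∧
      hdist b p ∈ Ioo (2 * s) (K / 2 * s) ∧ hdist b p ∈ Ioo (4 * t) (K * t) ∧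
      hdist b p ∈ Ioo (2 * u) (K / 2 * u) := by
    refine (eventually_hdist ?_).and <| (eventually_hdist ?_).and <| (eventually_hdist ?_).and <|
      (eventually_hdist ?_).and (eventually_hdist ?_)
    all_goals
      simp only [ma, mb]
      constructor <;> linarith
  obtain ⟨x, hx, e₁, e₂, e₃, e₄, e₅⟩ :=
    exists_mem_tri (by norm_num) (by norm_num) le_rfl (by norm_num) ev
  -- The common apex `z` is taken near `b`, so that `ax` is outer; the inner edges `ab` and `bx`
  -- impose nothing on it.
  have ev' : ∀ᶠ p in 𝓝 ((0 : ℝ) • a + (1 : ℝ) • b + (0 : ℝ) • x),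
      hdist a p ∈ Ioo (2 * r) (K / 2 * r) ∧ hdist x p ∈ Ioo (4 * t) (K * t) ∧
      hdist x p ∈ Ioo (2 * u) (K / 2 * u) ∧ hdist a p ∈ Ioo (4 * u) (K * u) := by
    simp only [zero_smul, one_smul, zero_add, add_zero]
    rw [hdist_comm b x] at e₄ e₅
    exact (eventually_hdist h.1).and <| (eventually_hdist e₄).and <| (eventually_hdist e₅).and
      (eventually_hdist ⟨by linarith, by linarith⟩)
  obtain ⟨z, hz, f₁, f₂, f₃, f₄⟩ :=
    exists_mem_tri le_rfl zero_le_one le_rfl (by norm_num) ev'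
  exact ⟨x, hx, z, hz, t, .inl (.inl h), .inl (.inr ⟨e₁, e₂, f₁, f₂, u, f₃, f₄⟩),
    .inl (.inl ⟨e₃, e₄⟩)⟩

lemma exists_subdivision_of_isOuter {K : ℝ} {a b c : ℝ × ℝ} {r s : ℝ}
    (h : IsOuter K a b c r s) :
    ∃ x ∈ tri a b c, ∃ z ∈ tri a b x, ∃ t, IsExtendable K a b z r s ∧
      IsExtendable K a x z r t ∧ IsExtendable K b x z s t := by
  obtain ⟨h₁, h₂, h₃, h₄, t, h₅, h₆⟩ := h
  have ev : ∀ q, hdist a q ∈ Ioo (2 * r) (K / 2 * r) → hdist b q ∈ Ioo (4 * s) (K * s) →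
      hdist b q ∈ Ioo (2 * t) (K / 2 * t) → hdist a q ∈ Ioo (4 * t) (K * t) →
      ∀ᶠ p in 𝓝 q, hdist a p ∈ Ioo (2 * r) (K / 2 * r) ∧ hdist b p ∈ Ioo (4 * s) (K * s) ∧
      hdist b p ∈ Ioo (2 * t) (K / 2 * t) ∧ hdist a p ∈ Ioo (4 * t) (K * t) :=
    fun q k₁ k₂ k₃ k₄ => (eventually_hdist k₁).and <| (eventually_hdist k₂).and <|
      (eventually_hdist k₃).and (eventually_hdist k₄)
  -- `x` lies near `c` and `z` near `x`, so `ab` stays outer with apex `z` and the same `t`, which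
  -- also serves as the scale of `x`.
  obtain ⟨x, hx, e₁, e₂, e₃, e₄⟩ := exists_mem_tri (a := a) (b := b) le_rfl le_rfl zero_le_one
    (by norm_num) (by simpa only [zero_smul, one_smul, zero_add] using ev c h₃ h₄ h₅ h₆)
  obtain ⟨z, hz, f₁, f₂, f₃, f₄⟩ := exists_mem_tri (a := a) (b := b) le_rfl le_rfl zero_le_one
    (by norm_num) (by simpa only [zero_smul, one_smul, zero_add] using ev x e₁ e₂ e₃ e₄)
  refine ⟨x, hx, z, hz, t, .inl (.inr ⟨h₁, h₂, f₁, f₂, t, f₃, f₄⟩), .inl (.inl ⟨e₁, e₄⟩),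
    .inr (.inl ?_)⟩
  rw [IsInner, hdist_comm]
  exact ⟨e₃, e₂⟩

lemma exists_subdivision {K : ℝ} (hK : 4 < K) {a b c : ℝ × ℝ} {r s : ℝ}
    (h : IsExtendable K a b c r s) :
    ∃ x ∈ tri a b c, ∃ z ∈ tri a b x, ∃ t, IsExtendable K a b z r s ∧
      IsExtendable K a x z r t ∧ IsExtendable K b x z s t := by
  rcases h with (h | h) | h
  · exact exists_subdivision_of_isInner hK h
  · exact exists_subdivision_of_isOuter h
  · obtain ⟨x, hx, z, hz, t, h₁, h₂, h₃⟩ : ∃ x ∈ tri b a c, ∃ z ∈ tri b a x, ∃ t,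
        IsExtendable K b a z s r ∧ IsExtendable K b x z s t ∧ IsExtendable K a x z r t :=
      h.elim (exists_subdivision_of_isInner hK) exists_subdivision_of_isOuter
    exact ⟨x, tri_swap a b c ▸ hx, z, tri_swap a b x ▸ hz, t, h₁.symm, h₃, h₂⟩

end PlaneTriangle

/-! ### 2-trees -/

/-- `IsTwoTree S F`: the vertex set `S` and the edge set `F` form a 2-tree, that is, they are
obtained from a single edge by joining new vertices to both ends of an edge. -/
inductive IsTwoTree {W : Type*} : Set W → Set (Sym2 W) → Prop
  | base {u v : W} (h : u ≠ v) : IsTwoTree {u, v} {s(u, v)}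
  | step {S : Set W} {F : Set (Sym2 W)} {p q w : W} (h : IsTwoTree S F) (hpq : s(p, q) ∈ F)
      (hw : w ∉ S) : IsTwoTree (insert w S) (insert s(w, p) (insert s(w, q) F))

namespace IsTwoTree

variable {W : Type*} {S : Set W} {F : Set (Sym2 W)}

lemma mem_of_mem (h : IsTwoTree S F) : ∀ e ∈ F, ∀ v ∈ e, v ∈ S := by
  induction h with
  | base => simp
  | @step S F p q w h hpq hw ih =>
    have hp := ih _ hpq p (by simp)
    have hq := ih _ hpq q (by simp)
    rintro e (rfl | rfl | he) v hv
    · rcases Sym2.mem_iff.1 hv with rfl | rfl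
      exacts [.inl rfl, .inr hp]
    · rcases Sym2.mem_iff.1 hv with rfl | rfl
      exacts [.inl rfl, .inr hq]
    · exact .inr (ih e he v hv)

end IsTwoTree

/-! ### Extendable drawings of 2-trees -/

namespace PlaneTriangle

open Set

variable {W : Type*}

/-- The open segment that represents an edge. -/
def edgeSegment (pos : W → ℝ × ℝ) : Sym2 W → Set (ℝ × ℝ) :=
  Sym2.lift ⟨fun u v => openSegment ℝ (pos u) (pos v), fun _ _ => openSegment_symm ..⟩

/-- The open triangle over an edge with the given apex. -/
def edgeTriangle (pos : W → ℝ × ℝ) (c : ℝ × ℝ) : Sym2 W → Set (ℝ × ℝ) :=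
  Sym2.lift ⟨fun u v => tri (pos u) (pos v) c, fun _ _ => tri_swap ..⟩

@[simp] lemma edgeSegment_mk (pos : W → ℝ × ℝ) (u v : W) :
    edgeSegment pos s(u, v) = openSegment ℝ (pos u) (pos v) := rfl

@[simp] lemma edgeTriangle_mk (pos : W → ℝ × ℝ) (c : ℝ × ℝ) (u v : W) :
    edgeTriangle pos c s(u, v) = tri (pos u) (pos v) c := rfl

/-- The cells of a drawing: vertices, open edges, and the open triangles reserved for the
extension of the edges. -/
def cell (pos : W → ℝ × ℝ) (apex : Sym2 W → ℝ × ℝ) : W ⊕ Sym2 W ⊕ Sym2 W → Set (ℝ × ℝ)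
  | .inl v => {pos v}
  | .inr (.inl e) => edgeSegment pos e
  | .inr (.inr e) => edgeTriangle pos (apex e) e

/-- The indices of the cells that belong to the vertices in `S` and the edges in `F`. -/
def cellIndices (S : Set W) (F : Set (Sym2 W)) : Set (W ⊕ Sym2 W ⊕ Sym2 W) :=
  {i | Sum.elim (· ∈ S) (Sum.elim (· ∈ F) (· ∈ F)) i}

/-- A drawing of the vertices in `S` and the edges in `F` with pairwise disjoint cells, in which
every edge can be extended. -/
structure IsExtendableDrawing (K : ℝ) (S : Set W) (F : Set (Sym2 W)) (pos : W → ℝ × ℝ)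
    (apex : Sym2 W → ℝ × ℝ) (scale : W → ℝ) : Prop where
  disjoint : (cellIndices S F).PairwiseDisjoint (cell pos apex)
  det_ne_zero : ∀ u v, s(u, v) ∈ F → det (pos u) (pos v) (apex s(u, v)) ≠ 0
  isExtendable : ∀ u v, s(u, v) ∈ F →
    IsExtendable K (pos u) (pos v) (apex s(u, v)) (scale u) (scale v)

/-- The cells of a single edge are pairwise disjoint. -/
lemma pairwiseDisjoint_edge {pos : W → ℝ × ℝ} {apex : Sym2 W → ℝ × ℝ} {u v : W}
    (hd : det (pos u) (pos v) (apex s(u, v)) ≠ 0) :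
    (cellIndices {u, v} {s(u, v)}).PairwiseDisjoint (cell pos apex) := by
  have hI : cellIndices {u, v} {s(u, v)} =
      {.inl u, .inl v, .inr (.inl s(u, v)), .inr (.inr s(u, v))} := by
    ext (i | i | i) <;> simp [cellIndices]
  set a := pos u
  set b := pos v
  set c := apex s(u, v)
  have hd₁ : det b c a ≠ 0 := by rwa [det_rotate]
  have hd₂ : det a c b ≠ 0 := by rw [det_swap, det_rotate, det_rotate]; exact neg_ne_zero.2 hd
  have h₁ : a ≠ b := by
    intro h
    simp [h, det] at hd
  have h₂ : a ∉ openSegment ℝ a b := openSegment_symm ℝ a b ▸ notMem_openSegment_of_det hd₁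
  have h₃ : b ∉ openSegment ℝ a b := notMem_openSegment_of_det hd₂
  have h₄ : a ∉ tri a b c := tri_rotate a b c ▸ notMem_tri hd₁
  have htri : tri a b c = tri a c b := by rw [tri_rotate, tri_rotate, tri_swap]
  have h₅ : b ∉ tri a b c := htri ▸ notMem_tri hd₂
  have h₆ : Disjoint (openSegment ℝ a b) (tri a b c) := htri ▸ disjoint_openSegment_tri hd₂
  rw [hI]
  simp only [pairwiseDisjoint_insert, pairwiseDisjoint_singleton, mem_insert_iff,
    mem_singleton_iff, forall_eq_or_imp, forall_eq, cell, edgeSegment_mk, edgeTriangle_mk,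
    disjoint_singleton_left]
  exact ⟨⟨⟨trivial, fun _ => h₆⟩, fun _ => h₃, fun _ => h₅⟩, fun _ => h₁, fun _ => h₂, fun _ => h₄⟩

lemma exists_isExtendableDrawing_base {K : ℝ} (hK : 4 < K) {u v : W} (huv : u ≠ v) :
    ∃ pos apex scale, IsExtendableDrawing K {u, v} {s(u, v)} pos apex scale := by
  classical
  let pos : W → ℝ × ℝ := fun w => if w = u then (0, 0) else (1, 0)
  -- The edge has length 1; `r` and `s` are chosen to make it inner.
  obtain ⟨r, hr⟩ := exists_between (show 2 / K < 1 / 2 by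
    rw [div_lt_div_iff₀ (by linarith) (by norm_num)]; linarith)
  obtain ⟨s, hs⟩ := exists_between (show 1 / K < 1 / 4 by
    rw [div_lt_div_iff₀ (by linarith) (by norm_num)]; linarith)
  have hr1 := (div_lt_iff₀ (show 0 < K by linarith)).1 hr.1
  have hs1 := (div_lt_iff₀ (show 0 < K by linarith)).1 hs.1
  have hr2 := hr.2
  have hs2 := hs.2
  have hd : det (pos u) (pos v) (0, 1) ≠ 0 := by simp [pos, huv.symm, det]
  have hd' : det (pos v) (pos u) (0, 1) ≠ 0 := by rw [det_swap]; exact neg_ne_zero.2 hd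
  have hE : IsExtendable K (pos u) (pos v) (0, 1) r s := by
    refine .inl (.inl ?_)
    simp only [IsInner, hdist, pos, huv.symm, if_true, if_false, mem_Ioo]
    norm_num
    refine ⟨⟨?_, ?_⟩, ?_, ?_⟩ <;> linarith
  refine ⟨pos, fun _ => (0, 1), fun w => if w = u then r else s, ?_, ?_, ?_⟩
  · exact pairwiseDisjoint_edge hd
  · intro a b hab
    rcases Sym2.eq_iff.1 hab with ⟨rfl, rfl⟩ | ⟨rfl, rfl⟩
    exacts [hd, hd']
  · intro a b hab
    rcases Sym2.eq_iff.1 hab with ⟨rfl, rfl⟩ | ⟨rfl, rfl⟩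
    · simpa [huv.symm] using hE
    · simpa [huv.symm] using hE.symm

/-- Replacing one member of a disjoint family by disjoint subsets of it keeps the family
disjoint. -/
lemma pairwiseDisjoint_refine {ι α : Type*} {I J : Set ι} {f g : ι → Set α} {i₀ : ι}
    (hI : I.PairwiseDisjoint f) (hi₀ : i₀ ∈ I) (hJ : J.PairwiseDisjoint g)
    (hJs : ∀ j ∈ J, g j ⊆ f i₀) (hg : ∀ i ∈ I, i ≠ i₀ → g i = f i) (h₀ : i₀ ∈ J) :
    (I ∪ J).PairwiseDisjoint g := by
  have key : ∀ i ∈ I, i ∉ J → ∀ j ∈ J, Disjoint (g i) (g j) := by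
    intro i hi hiJ j hj
    have hne : i ≠ i₀ := fun h => hiJ (h ▸ h₀)
    rw [hg i hi hne]
    exact (hI hi hi₀ hne).mono_right (hJs j hj)
  intro i hi j hj hij
  by_cases hiJ : i ∈ J <;> by_cases hjJ : j ∈ J
  · exact hJ hiJ hjJ hij
  · exact (key j (hj.resolve_right hjJ) hjJ i hiJ).symm
  · exact key i (hi.resolve_right hiJ) hiJ j hjJ
  · have hi' := hi.resolve_right hiJ
    have hj' := hj.resolve_right hjJ
    have hii : i ≠ i₀ := fun h => hiJ (h ▸ h₀)
    have hjj : j ≠ i₀ := fun h => hjJ (h ▸ h₀)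
    show Disjoint (g i) (g j)
    rw [hg i hi' hii, hg j hj' hjj]
    exact hI hi' hj' hij

/-- The cells that arise when a new vertex is joined to both ends of an edge are pairwise
disjoint. -/
lemma pairwiseDisjoint_step {pos : W → ℝ × ℝ} {apex : Sym2 W → ℝ × ℝ} {p q w : W} {z : ℝ × ℝ}
    (hd : det (pos p) (pos q) (pos w) ≠ 0) (hz : z ∈ tri (pos p) (pos q) (pos w))
    (h₁ : apex s(p, q) = z) (h₂ : apex s(w, p) = z) (h₃ : apex s(w, q) = z) :
    ({.inl w, .inr (.inl s(w, p)), .inr (.inl s(w, q)), .inr (.inr s(p, q)), .inr (.inr s(w, p)),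
      .inr (.inr s(w, q))} : Set (W ⊕ Sym2 W ⊕ Sym2 W)).PairwiseDisjoint (cell pos apex) ∧
    ∀ e ∈ ({s(p, q), s(w, p), s(w, q)} : Set (Sym2 W)),
      edgeTriangle pos (apex e) e ⊆ tri (pos p) (pos q) (pos w) := by
  set a := pos p with ha
  set b := pos q with hb
  set x := pos w with hx
  have hd' : det b a x ≠ 0 := by rw [det_swap]; exact neg_ne_zero.2 hd
  have hz' : z ∈ tri b a x := tri_swap a b x ▸ hz
  have hzx : z ∈ tri x a b := by rwa [tri_rotate]
  have hzx' : z ∈ tri x b a := by rwa [tri_rotate]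
  have ht : tri a b z ⊆ tri a b x := tri_subset hz
  have hta : tri x a z ⊆ tri a b x := tri_rotate x a b ▸ tri_subset hzx
  have htb : tri x b z ⊆ tri a b x := by
    rw [tri_swap a b x, ← tri_rotate x b a]
    exact tri_subset hzx'
  have sa : x ∉ openSegment ℝ x a := openSegment_symm ℝ a x ▸ notMem_openSegment_of_det hd
  have sb : x ∉ openSegment ℝ x b := openSegment_symm ℝ b x ▸ notMem_openSegment_of_det hd'
  have hxt : x ∉ tri a b x := notMem_tri hd
  have ss : Disjoint (openSegment ℝ x a) (openSegment ℝ x b) := by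
    rw [openSegment_symm ℝ x a, openSegment_symm ℝ x b]
    exact disjoint_openSegment_openSegment hd
  have sta : Disjoint (openSegment ℝ x a) (tri a b x) :=
    openSegment_symm ℝ a x ▸ disjoint_openSegment_tri hd
  have stb : Disjoint (openSegment ℝ x b) (tri a b x) := by
    rw [tri_swap, openSegment_symm]
    exact disjoint_openSegment_tri hd'
  have t₁ : Disjoint (tri a b z) (tri x a z) := tri_swap a x z ▸ disjoint_tri_tri hd hz
  have t₂ : Disjoint (tri a b z) (tri x b z) := by
    rw [tri_swap, tri_swap x]
    exact disjoint_tri_tri hd' hz'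
  have t₃ : Disjoint (tri x a z) (tri x b z) :=
    disjoint_tri_tri (by rwa [← det_rotate]) hzx
  constructor
  · simp only [pairwiseDisjoint_insert, pairwiseDisjoint_singleton, mem_insert_iff,
      mem_singleton_iff, forall_eq_or_imp, forall_eq, cell, edgeSegment_mk, edgeTriangle_mk,
      disjoint_singleton_left, ← ha, ← hb, ← hx, h₁, h₂, h₃]
    refine ⟨⟨⟨⟨⟨trivial, fun _ => t₃⟩, fun _ => t₁, fun _ => t₂⟩, ?_⟩, ?_⟩, ?_⟩
    · exact ⟨fun _ => stb.mono_right ht, fun _ => stb.mono_right hta, fun _ => stb.mono_right htb⟩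
    · exact ⟨fun _ => ss, fun _ => sta.mono_right ht, fun _ => sta.mono_right hta,
        fun _ => sta.mono_right htb⟩
    · exact ⟨fun _ => sa, fun _ => sb, fun _ h => hxt (ht h), fun _ h => hxt (hta h),
        fun _ h => hxt (htb h)⟩
  · rintro e (rfl | rfl | rfl)
    · rwa [h₁]
    · rwa [h₂]
    · rwa [h₃]

lemma IsExtendableDrawing.step {K : ℝ} (hK : 4 < K) {S : Set W} {F : Set (Sym2 W)}
    {pos : W → ℝ × ℝ} {apex : Sym2 W → ℝ × ℝ} {scale : W → ℝ}
    (hD : IsExtendableDrawing K S F pos apex scale) (hFS : ∀ e ∈ F, ∀ v ∈ e, v ∈ S)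
    {p q w : W} (hpq : s(p, q) ∈ F) (hw : w ∉ S) :
    ∃ pos apex scale, IsExtendableDrawing K (insert w S) (insert s(w, p) (insert s(w, q) F))
      pos apex scale := by
  classical
  obtain ⟨x, hx, z, hz, t, h₁, h₂, h₃⟩ := exists_subdivision hK (hD.isExtendable p q hpq)
  have hd := hD.det_ne_zero p q hpq
  have hdx := det_ne_zero_of_mem_tri hd hx
  have hdz := det_ne_zero_of_mem_tri hdx hz
  set a := pos p with ha
  set b := pos q with hb
  have hwS : ∀ v ∈ S, v ≠ w := fun v hv h => hw (h ▸ hv)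
  have hpw := hwS p (hFS _ hpq p (by simp))
  have hqw := hwS q (hFS _ hpq q (by simp))
  have hwF : ∀ v, s(w, v) ∉ F := fun v hv => hw (hFS _ hv w (by simp))
  have hFw : ∀ v, s(v, w) ∉ F := fun v hv => hw (hFS _ hv w (by simp))
  let pos' := Function.update pos w x
  let scale' := Function.update scale w t
  -- One point `z` serves as apex of `ab`, `ax` and `bx`.
  let apex' : Sym2 W → ℝ × ℝ := fun e =>
    if e = s(p, q) ∨ e = s(w, p) ∨ e = s(w, q) then z else apex e
  have pw : pos' w = x := Function.update_self ..
  have pv : ∀ v, v ≠ w → pos' v = pos v := fun v hv => Function.update_of_ne hv ..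
  have sw : scale' w = t := Function.update_self ..
  have sv : ∀ v, v ≠ w → scale' v = scale v := fun v hv => Function.update_of_ne hv ..
  have a₁ : apex' s(p, q) = z := if_pos (.inl rfl)
  have a₂ : apex' s(w, p) = z := if_pos (.inr (.inl rfl))
  have a₃ : apex' s(w, q) = z := if_pos (.inr (.inr rfl))
  have a₄ : ∀ e ∈ F, e ≠ s(p, q) → apex' e = apex e := fun e he hne => if_neg (by
    rintro (h | rfl | rfl)
    exacts [hne h, hwF _ he, hwF _ he])
  -- A symmetric property of edges needs checking only on `pq`, `wp`, `wq` and the untouched edges.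
  have key : ∀ (P : W → W → Prop), (∀ u v, P u v → P v u) → P p q → P w p → P w q →
      (∀ u v, s(u, v) ∈ F → s(u, v) ≠ s(p, q) → u ≠ w → v ≠ w → P u v) →
      ∀ u v, s(u, v) ∈ insert s(w, p) (insert s(w, q) F) → P u v := by
    intro P hP k₁ k₂ k₃ k₄ u v huv
    rcases huv with h | h | h
    · rcases Sym2.eq_iff.1 h with ⟨rfl, rfl⟩ | ⟨rfl, rfl⟩
      exacts [k₂, hP _ _ k₂]
    · rcases Sym2.eq_iff.1 h with ⟨rfl, rfl⟩ | ⟨rfl, rfl⟩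
      exacts [k₃, hP _ _ k₃]
    · by_cases hne : s(u, v) = s(p, q)
      · rcases Sym2.eq_iff.1 hne with ⟨rfl, rfl⟩ | ⟨rfl, rfl⟩
        exacts [k₁, hP _ _ k₁]
      · exact k₄ u v h hne (hwS _ (hFS _ h _ (by simp))) (hwS _ (hFS _ h _ (by simp)))
  have hza : det x a z ≠ 0 :=
    det_ne_zero_of_mem_tri (c := b) (by rwa [← det_rotate]) (by rwa [tri_rotate])
  have hzb : det x b z ≠ 0 :=
    det_ne_zero_of_mem_tri (c := a) (by rw [← det_rotate, det_swap]; exact neg_ne_zero.2 hdx)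
      (by rwa [tri_rotate, tri_swap])
  refine ⟨pos', apex', scale', ?_, key _ ?_ ?_ ?_ ?_ ?_, key _ ?_ ?_ ?_ ?_ ?_⟩
  · have hstep := pairwiseDisjoint_step (pos := pos') (apex := apex') (p := p) (q := q) (w := w)
      (z := z) (by rwa [pv p hpw, pv q hqw, pw]) (by rwa [pv p hpw, pv q hqw, pw]) a₁ a₂ a₃
    have hsub : tri (pos' p) (pos' q) (pos' w) ⊆ tri a b (apex s(p, q)) := by
      rw [pv p hpw, pv q hqw, pw]
      exact tri_subset hx
    -- Only the triangle of `pq` changes: the new cells, among them its own smaller triangle, all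
    -- lie in the old one.
    refine (pairwiseDisjoint_refine (i₀ := .inr (.inr s(p, q))) hD.disjoint hpq hstep.1
      ?_ ?_ (by simp)).subset ?_
    · rintro j (rfl | rfl | rfl | rfl | rfl | rfl)
      · simpa [cell, pw] using hx
      · simpa [cell, pw, pv p hpw, openSegment_symm ℝ x] using openSegment_subset_tri hx
      · simp only [cell, edgeSegment_mk, edgeTriangle_mk, pw, pv q hqw]
        rw [openSegment_symm, tri_swap]
        exact openSegment_subset_tri (tri_swap a b _ ▸ hx)
      all_goals exact (hstep.2 _ (by simp)).trans hsub
    · have hmk : ∀ u v, s(u, v) ∈ F → u ≠ w ∧ v ≠ w := fun u v h =>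
        ⟨hwS _ (hFS _ h _ (by simp)), hwS _ (hFS _ h _ (by simp))⟩
      rintro (v | e | e) hi hne
      · simp [cell, pv v (hwS v hi)]
      · induction e with | _ u v
        simp [cell, pv u (hmk u v hi).1, pv v (hmk u v hi).2]
      · have := a₄ e hi (fun h => hne (h ▸ rfl))
        induction e with | _ u v
        simp [cell, pv u (hmk u v hi).1, pv v (hmk u v hi).2, this]
    · rintro (v | e | e) h
      · rcases h with rfl | h
        exacts [.inr (by simp), .inl h]
      all_goals
        rcases h with rfl | rfl | h
        exacts [.inr (by simp), .inr (by simp), .inl h]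
  · intro u v h
    rw [det_swap, Sym2.eq_swap]
    exact neg_ne_zero.2 h
  · rw [a₁, pv p hpw, pv q hqw]
    exact hdz
  · rw [a₂, pv p hpw, pw]
    exact hza
  · rw [a₃, pv q hqw, pw]
    exact hzb
  · intro u v huv hne hu hv
    rw [a₄ _ huv hne, pv u hu, pv v hv]
    exact hD.det_ne_zero u v huv
  · intro u v h
    rw [Sym2.eq_swap]
    exact h.symm
  · rw [a₁, pv p hpw, pv q hqw, sv p hpw, sv q hqw]
    exact h₁
  · rw [a₂, pv p hpw, pw, sv p hpw, sw]
    exact h₂.symm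
  · rw [a₃, pv q hqw, pw, sv q hqw, sw]
    exact h₃.symm
  · intro u v huv hne hu hv
    rw [a₄ _ huv hne, pv u hu, pv v hv, sv u hu, sv v hv]
    exact hD.isExtendable u v huv

lemma exists_isExtendableDrawing {K : ℝ} (hK : 4 < K) {S : Set W} {F : Set (Sym2 W)}
    (h : IsTwoTree S F) : ∃ pos apex scale, IsExtendableDrawing K S F pos apex scale := by
  induction h with
  | base huv => exact exists_isExtendableDrawing_base hK huv
  | step h hpq hw ih =>
    obtain ⟨pos, apex, scale, hD⟩ := ih
    exact hD.step hK h.mem_of_mem hpq hw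

end PlaneTriangle

/-! ### Extending cliques in 2-trees -/

namespace IsTwoTree

open Set

variable {W : Type*} {S : Set W} {F : Set (Sym2 W)}

lemma nonempty (h : IsTwoTree S F) : S.Nonempty := by
  cases h <;> exact insert_nonempty _ _

lemma exists_mem_edge (h : IsTwoTree S F) : ∀ v ∈ S, ∃ u, s(v, u) ∈ F := by
  induction h with
  | @base u v huv =>
    rintro w (rfl | rfl)
    exacts [⟨v, rfl⟩, ⟨u, Sym2.eq_swap⟩]
  | @step S F p q w h hpq hw ih =>
    rintro v (rfl | hv)
    · exact ⟨p, .inl rfl⟩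
    · obtain ⟨u, hu⟩ := ih v hv
      exact ⟨u, .inr (.inr hu)⟩

/-- All pairs of distinct elements of `C` belong to `F`. -/
def IsCliqueIn (F : Set (Sym2 W)) (C : Set W) : Prop :=
  ∀ u ∈ C, ∀ v ∈ C, u ≠ v → s(u, v) ∈ F

lemma exists_subset_edge (h : IsTwoTree S F) {C : Set W} (hCS : C ⊆ S) (hC : IsCliqueIn F C)
    (hcard : C.encard ≤ 2) : ∃ p q, s(p, q) ∈ F ∧ C ⊆ {p, q} := by
  rcases C.eq_empty_or_nonempty with rfl | ⟨p, hp⟩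
  · obtain ⟨v, hv⟩ := h.nonempty
    obtain ⟨u, hu⟩ := h.exists_mem_edge v hv
    exact ⟨v, u, hu, empty_subset _⟩
  · by_cases hq : ∃ q ∈ C, q ≠ p
    · obtain ⟨q, hq, hqp⟩ := hq
      refine ⟨p, q, hC p hp q hq hqp.symm, ?_⟩
      have hsub : {p, q} ⊆ C := by
        rintro x (rfl | rfl)
        exacts [hp, hq]
      refine ((toFinite {p, q}).eq_of_subset_of_encard_le hsub ?_).ge
      rwa [encard_pair hqp.symm]
    · push Not at hq
      obtain ⟨u, hu⟩ := h.exists_mem_edge p (hCS hp)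
      exact ⟨p, u, hu, fun x hx => .inl (hq x hx)⟩

/-- Add the vertices of `D` one at a time: before each addition the clique has at most two vertices,
hence lies in an edge to which the new vertex can be joined. -/
lemma exists_extend_clique (h : IsTwoTree S F) {C D : Set W} (hD : D.Finite) (hCS : C ⊆ S)
    (hC : IsCliqueIn F C) (hDS : Disjoint D S) (hcard : (C ∪ D).encard ≤ 3) :
    ∃ F', F ⊆ F' ∧ IsTwoTree (S ∪ D) F' ∧ IsCliqueIn F' (C ∪ D) := by
  induction D, hD using Set.Finite.induction_on with
  | empty => exact ⟨F, Subset.rfl, by simpa using h, by simpa using hC⟩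
  | @insert w D hwD _ ih =>
    rw [disjoint_insert_left] at hDS
    have hw : w ∉ S ∪ D := fun hw => hw.elim hDS.1 hwD
    have hwC : w ∉ C ∪ D := fun hw' => hw (hw'.imp (@hCS w) id)
    rw [union_insert, encard_insert_of_notMem hwC] at hcard
    have hcard' : (C ∪ D).encard ≤ 2 := by
      rw [show (3 : ℕ∞) = 2 + 1 by norm_num] at hcard
      exact (ENat.add_le_add_iff_right (by simp)).1 hcard
    obtain ⟨F', hF, h', hcl⟩ := ih hDS.2 (hcard'.trans (by norm_num))
    obtain ⟨p, q, hpq, hsub⟩ := h'.exists_subset_edge (union_subset_union_left D hCS) hcl hcard'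
    refine ⟨_, fun e he => .inr (.inr (hF he)), union_insert ▸ h'.step hpq hw, ?_⟩
    have key : ∀ x ∈ C ∪ D, s(w, x) ∈ insert s(w, p) (insert s(w, q) F') := by
      intro x hx
      rcases hsub hx with rfl | rfl
      exacts [.inl rfl, .inr (.inl rfl)]
    rw [union_insert]
    rintro u (rfl | hu) v (rfl | hv) huv
    · exact absurd rfl huv
    · exact key v hv
    · exact Sym2.eq_swap (a := v) ▸ key u hu
    · exact .inr (.inr (hcl u hu v hv huv))

end IsTwoTree

/-! ### Embedding series-parallel graphs and graphs of treewidth at most 2 into 2-trees -/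

namespace SimpleGraph

open Set IsTwoTree

section SeriesParallel

variable {V : Type*} {G : SimpleGraph V} {H : G.Subgraph} {s t : V}

lemma IsTwoTerminalSeriesParallel.mem_verts (h : IsTwoTerminalSeriesParallel G H s t) :
    s ∈ H.verts ∧ t ∈ H.verts := by
  induction h with
  | edge h => simp
  | series _ _ _ ih₁ ih₂ => exact ⟨.inl ih₁.1, .inr ih₂.2⟩
  | parallel _ _ _ ih₁ ih₂ => exact ⟨.inl ih₁.1, .inl ih₁.2⟩

lemma IsTwoTerminalSeriesParallel.ne (h : IsTwoTerminalSeriesParallel G H s t) : s ≠ t := by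
  induction h with
  | edge h => exact h.ne
  | @series H₁ H₂ s m t h₁ h₂ h ih₁ ih₂ =>
    rintro rfl
    have : s ∈ H₁.verts ∩ H₂.verts := ⟨h₁.mem_verts.1, h₂.mem_verts.2⟩
    rw [h] at this
    exact ih₁ this
  | parallel _ _ _ ih₁ _ => exact ih₁

/-- A two-terminal series-parallel graph can be glued onto an edge of a 2-tree. -/
lemma IsTwoTerminalSeriesParallel.exists_isTwoTree (h : IsTwoTerminalSeriesParallel G H s t) :
    ∀ S F, IsTwoTree S F → s(s, t) ∈ F → S ∩ H.verts ⊆ {s, t} →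
      ∃ F', F ⊆ F' ∧ IsTwoTree (S ∪ H.verts) F' ∧ H.edgeSet ⊆ F' := by
  induction h with
  | @edge s t h =>
    intro S F hT hst _
    refine ⟨F, Subset.rfl, ?_, by simpa using hst⟩
    have : S ∪ (G.subgraphOfAdj h).verts = S := by
      refine union_eq_left.2 ?_
      rintro x (rfl | rfl)
      · exact hT.mem_of_mem _ hst _ (by simp)
      · exact hT.mem_of_mem _ hst _ (by simp)
    rwa [this]
  | @series H₁ H₂ s m t h₁ h₂ h ih₁ ih₂ =>
    intro S F hT hst hS
    have hm₁ := h₁.mem_verts.2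
    have hmS : m ∉ S := fun hm => (hS ⟨hm, .inl hm₁⟩).elim h₁.ne.symm h₂.ne
    have ht₁ : t ∉ H₁.verts := fun ht =>
      h₂.ne.symm (h.le ⟨ht, h₂.mem_verts.2⟩)
    have hs₂ : s ∉ H₂.verts := fun hs =>
      h₁.ne (h.le ⟨h₁.mem_verts.1, hs⟩)
    -- Join the middle terminal `m` to `s` and `t`, then glue the two parts onto the edges `sm` and
    -- `mt`.
    obtain ⟨F₁, hF₁, hT₁, hH₁⟩ := ih₁ _ _ (hT.step hst hmS) (.inl Sym2.eq_swap) (by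
      rintro x ⟨rfl | hx, hx₁⟩
      · exact .inr rfl
      · rcases hS ⟨hx, .inl hx₁⟩ with rfl | rfl
        exacts [.inl rfl, absurd hx₁ ht₁])
    obtain ⟨F₂, hF₂, hT₂, hH₂⟩ := ih₂ _ _ hT₁ (hF₁ (.inr (.inl rfl))) (by
      rintro x ⟨(rfl | hx) | hx₁, hx₂⟩
      · exact .inl rfl
      · rcases hS ⟨hx, .inr hx₂⟩ with rfl | rfl
        exacts [absurd hx₂ hs₂, .inr rfl]
      · exact .inl (h.le ⟨hx₁, hx₂⟩))
    refine ⟨F₂, fun e he => hF₂ (hF₁ (.inr (.inr he))), ?_, ?_⟩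
    · have : insert m S ∪ H₁.verts ∪ H₂.verts = S ∪ (H₁ ⊔ H₂).verts := by
        rw [insert_union, insert_eq_of_mem (.inr hm₁), union_assoc]
        rfl
      rwa [← this]
    · rw [Subgraph.edgeSet_sup]
      exact union_subset (hH₁.trans hF₂) hH₂
  | @parallel H₁ H₂ s t h₁ h₂ h ih₁ ih₂ =>
    intro S F hT hst hS
    obtain ⟨F₁, hF₁, hT₁, hH₁⟩ := ih₁ _ _ hT hst fun x hx => hS ⟨hx.1, .inl hx.2⟩
    obtain ⟨F₂, hF₂, hT₂, hH₂⟩ := ih₂ _ _ hT₁ (hF₁ hst) (by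
      rintro x ⟨hx | hx, hx₂⟩
      exacts [hS ⟨hx, .inr hx₂⟩, h.le ⟨hx, hx₂⟩])
    refine ⟨F₂, hF₁.trans hF₂, union_assoc .. ▸ hT₂, ?_⟩
    rw [Subgraph.edgeSet_sup]
    exact union_subset (hH₁.trans hF₂) hH₂

lemma IsSeriesParallel.exists_isTwoTree (h : G.IsSeriesParallel) :
    ∃ F, IsTwoTree univ F ∧ G.edgeSet ⊆ F := by
  obtain ⟨s, t, h⟩ := h
  obtain ⟨F, -, hT, hF⟩ := h.exists_isTwoTree _ _ (.base h.ne) rfl inter_subset_left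
  exact ⟨F, by simpa using hT, by simpa using hF⟩

end SeriesParallel

section Treewidth

variable {V ι : Type*} {G : SimpleGraph V}

/-- In a tree decomposition, a bag meets the bags of an adjacent connected part of the tree only
inside the bag at which it is attached. -/
lemma TreeDecomposition.mem_bag_of_adj (D : G.TreeDecomposition ι) {i j a : ι}
    (hij : D.tree.Adj i j) (p : D.tree.Walk j a) (hp : i ∉ p.support) {v : V}
    (hi : v ∈ D.bag i) (ha : v ∈ D.bag a) : v ∈ D.bag j := by
  by_contra hj
  -- The edge `ij` is a bridge. But the nodes whose bags contain `v` would connect `i` to `a`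
  -- without `j`, and `p` connects `j` to `a` without `i`.
  have hb := isAcyclic_iff_forall_adj_isBridge.1 D.isTree.isAcyclic hij
  rw [isBridge_iff] at hb
  apply hb
  have h₁ : (D.tree.deleteEdges {s(i, j)}).Reachable i a := by
    let φ : D.tree.induce {k | v ∈ D.bag k} →g D.tree.deleteEdges {s(i, j)} :=
      { toFun := Subtype.val
        map_rel' := by
          rintro ⟨x, hx⟩ ⟨y, hy⟩ hxy
          rw [deleteEdges_adj]
          refine ⟨hxy, fun h => ?_⟩
          rcases Sym2.eq_iff.1 h with ⟨rfl, rfl⟩ | ⟨rfl, rfl⟩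
          exacts [hj hy, hj hx] }
    exact (D.preconnected_induce v ⟨i, hi⟩ ⟨a, ha⟩).map φ
  have h₂ : (D.tree.deleteEdges {s(i, j)}).Reachable j a :=
    ⟨p.toDeleteEdge s(i, j) fun h => hp (p.fst_mem_support_of_mem_edges h)⟩
  exact h₁.trans h₂.symm

lemma TreeDecomposition.exists_isTwoTree [Finite V] [Finite ι] (D : G.TreeDecomposition ι)
    (hD : ∀ i, (D.bag i).encard ≤ 3) :
    ∃ (F : Set (Sym2 (V ⊕ Bool))), IsTwoTree univ F ∧
      ∀ u v, G.Adj u v → s(.inl u, .inl v) ∈ F := by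
  let f : V → V ⊕ Bool := .inl
  have hf : Function.Injective f := Sum.inl_injective
  -- Two auxiliary vertices supply a starting edge, however small `V` and the bags are.
  let S₀ : Set (V ⊕ Bool) := {.inr false, .inr true}
  let P : Set ι → Prop := fun A =>
    A.Nonempty ∧ (∀ a ∈ A, ∀ b ∈ A, ∃ p : D.tree.Walk a b, ∀ x ∈ p.support, x ∈ A) ∧
    ∃ F, IsTwoTree (S₀ ∪ f '' ⋃ a ∈ A, D.bag a) F ∧ ∀ a ∈ A, IsCliqueIn F (f '' D.bag a)
  have hcard : ∀ i, (f '' D.bag i).encard ≤ 3 := fun i => by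
    rw [hf.encard_image]; exact hD i
  have hfS : ∀ B : Set V, Disjoint (f '' B) S₀ := by
    intro B
    rw [Set.disjoint_left]
    rintro _ ⟨x, -, rfl⟩ (h | h) <;> cases h
  have hP : ∃ A, P A := by
    obtain ⟨r⟩ := D.isTree.connected.nonempty
    obtain ⟨F, -, hT, hF⟩ := (IsTwoTree.base (u := .inr false) (v := .inr true)
      (by simp)).exists_extend_clique (C := ∅) (toFinite (f '' D.bag r)) (empty_subset _)
      (by simp [IsCliqueIn]) (hfS _) (by simpa using hcard r)
    refine ⟨{r}, singleton_nonempty r, ?_, F, by simpa using hT, by simpa using hF⟩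
    rintro a rfl b rfl
    exact ⟨.nil, by simp⟩
  -- A maximal connected set of nodes whose bags are cliques of a 2-tree is everything: otherwise it
  -- can be enlarged by a neighbouring node.
  obtain ⟨A, hA⟩ := (toFinite {A | P A}).exists_maximal hP
  obtain ⟨⟨r, hr⟩, hconn, F, hT, hF⟩ := hA.prop
  have hAuniv : ∀ i, i ∈ A := by
    by_contra! hne
    obtain ⟨i₀, hi₀⟩ := hne
    obtain ⟨w⟩ := D.isTree.connected.preconnected r i₀
    obtain ⟨d, -, hj, hi⟩ := w.exists_boundary_dart A hr hi₀
    obtain ⟨⟨j, i⟩, hji⟩ := d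
    replace hji : D.tree.Adj j i := hji
    replace hj : j ∈ A := hj
    replace hi : i ∉ A := hi
    set U := ⋃ a ∈ A, D.bag a with hU
    -- The old vertices of the new bag lie in the bag of `j`, hence already form a clique.
    have hsub : D.bag i ∩ U ⊆ D.bag j := by
      rintro v ⟨hv, hvU⟩
      obtain ⟨a, ha, hva⟩ := mem_iUnion₂.1 hvU
      obtain ⟨p, hp⟩ := hconn j hj a ha
      exact D.mem_bag_of_adj hji.symm p (fun h => hi (hp i h)) hv hva
    have hbag : f '' (D.bag i ∩ U) ∪ f '' (D.bag i \ U) = f '' D.bag i := by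
      rw [← image_union, inter_union_sdiff]
    obtain ⟨F', hFF', hT', hF'⟩ := hT.exists_extend_clique (C := f '' (D.bag i ∩ U))
      (toFinite (f '' (D.bag i \ U)))
      ((image_mono inter_subset_right).trans subset_union_right)
      (fun u hu v hv huv => hF j hj u (image_mono hsub hu) v (image_mono hsub hv) huv)
      (disjoint_union_right.2 ⟨hfS _, (disjoint_image_iff hf).2 disjoint_sdiff_left⟩)
      (by rw [hbag]; exact hcard i)
    rw [hbag] at hF'
    have hPi : P (insert i A) := by
      refine ⟨insert_nonempty _ _, ?_, F', ?_, ?_⟩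
      · have hto : ∀ a ∈ A, ∃ p : D.tree.Walk a i, ∀ x ∈ p.support, x ∈ insert i A := by
          intro a ha
          obtain ⟨p, hp⟩ := hconn a ha j hj
          refine ⟨p.concat hji, fun x hx => ?_⟩
          rw [Walk.support_concat] at hx
          rcases List.mem_append.1 hx with hx | hx
          · exact .inr (hp x hx)
          · exact .inl (by simpa using hx)
        rintro a (rfl | ha) b (rfl | hb)
        · exact ⟨.nil, by simp⟩
        · obtain ⟨p, hp⟩ := hto b hb
          exact ⟨p.reverse, by simpa using hp⟩
        · exact hto a ha
        · obtain ⟨p, hp⟩ := hconn a ha b hb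
          exact ⟨p, fun x hx => .inr (hp x hx)⟩
      · convert hT' using 1
        rw [biUnion_insert, union_assoc, ← image_union, ← hU, union_sdiff_self, union_comm U]
      · rintro a (rfl | ha)
        · exact hF'
        · exact fun u hu v hv huv => hFF' (hF a ha u hu v hv huv)
    exact hi (hA.le_of_ge hPi (subset_insert i A) (mem_insert i A))
  refine ⟨F, ?_, fun u v huv => ?_⟩
  · convert hT using 1
    symm
    rw [eq_univ_iff_forall]
    rintro (v | b | b)
    · obtain ⟨i, hi⟩ := D.exists_mem_bag v
      exact .inr ⟨v, mem_biUnion (hAuniv i) hi, rfl⟩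
    · exact .inl (.inl rfl)
    · exact .inl (.inr rfl)
  · obtain ⟨i, hu, hv⟩ := D.exists_adj_mem_bag u v huv
    exact hF i (hAuniv i) _ ⟨u, hu, rfl⟩ _ ⟨v, hv, rfl⟩ (hf.ne huv.ne)

lemma exists_isTwoTree_of_treewidth_le_two [Finite V] (h : G.treewidth ≤ 2) :
    ∃ (F : Set (Sym2 (V ⊕ Bool))), IsTwoTree univ F ∧
      ∀ u v, G.Adj u v → s(.inl u, .inl v) ∈ F := by
  -- A strict bound on the infimum produces an actual decomposition of width at most 2.
  have h' : G.treewidth < 3 := h.trans_lt (by norm_num)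
  simp only [treewidth, iInf_lt_iff] at h'
  obtain ⟨ι, hι, D, hD⟩ := h'
  refine D.exists_isTwoTree fun i => ?_
  have h₁ : D.width ≤ 2 := by
    rw [show (3 : ℕ∞) = 2 + 1 by norm_num] at hD
    exact Order.le_of_lt_add_one hD
  rw [TreeDecomposition.width, tsub_le_iff_right] at h₁
  exact (le_iSup (fun i => (D.bag i).encard) i).trans (h₁.trans (by norm_num))

end Treewidth

end SimpleGraph

/-! ### Squeezing the drawing and bounding the ratio -/

namespace PlaneTriangle

open Filter Topology

/-- The linear map to the Euclidean plane that scales the second coordinate. -/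
noncomputable def squeeze (c : ℝ) : ℝ × ℝ →ₗ[ℝ] EuclideanSpace ℝ (Fin 2) where
  toFun p := !₂[p.1, c * p.2]
  map_add' p q := by ext i; fin_cases i <;> simp [mul_add]
  map_smul' r p := by ext i; fin_cases i <;> simp [mul_left_comm]

lemma squeeze_injective {c : ℝ} (hc : c ≠ 0) : Function.Injective (squeeze c) := by
  intro p q h
  have h₀ := congrArg (· 0) h
  have h₁ := congrArg (· 1) h
  simp [squeeze, hc] at h₀ h₁
  exact Prod.ext h₀ h₁

lemma dist_squeeze (c : ℝ) (p q : ℝ × ℝ) :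
    dist (squeeze c p) (squeeze c q) = √((p.1 - q.1) ^ 2 + (c * p.2 - c * q.2) ^ 2) := by
  simp [EuclideanSpace.dist_eq, squeeze, Real.dist_eq, sq_abs]

lemma hdist_le_dist_squeeze (c : ℝ) (p q : ℝ × ℝ) :
    hdist p q ≤ dist (squeeze c p) (squeeze c q) := by
  rw [dist_squeeze]
  exact Real.abs_le_sqrt (by nlinarith [sq_nonneg (c * p.2 - c * q.2)])

lemma tendsto_dist_squeeze (p q : ℝ × ℝ) :
    Tendsto (fun c => dist (squeeze c p) (squeeze c q)) (𝓝[>] 0) (𝓝 (hdist p q)) := by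
  have hc : Continuous fun c : ℝ => √((p.1 - q.1) ^ 2 + (c * p.2 - c * q.2) ^ 2) := by fun_prop
  have := (hc.tendsto 0).mono_left (nhdsWithin_le_nhds (s := Set.Ioi 0))
  simpa [dist_squeeze, hdist, Real.sqrt_sq_eq_abs] using this

end PlaneTriangle

namespace SimpleGraph

open Filter Topology PlaneTriangle

variable {V W : Type*} {G : SimpleGraph V}

/-- Subgraphs of a graph with an extendable drawing have a planar straight-line drawing. -/
noncomputable def drawingOfExtendable {K : ℝ} {F : Set (Sym2 W)} {pos : W → ℝ × ℝ}
    {apex : Sym2 W → ℝ × ℝ} {scale : W → ℝ} (hD : IsExtendableDrawing K Set.univ F pos apex scale)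
    {f : V → W} (hf : Function.Injective f) (hG : ∀ u v, G.Adj u v → s(f u, f v) ∈ F)
    {c : ℝ} (hc : c ≠ 0) : G.PlanarStraightLineDrawing where
  pos v := squeeze c (pos (f v))
  injective_pos := by
    refine (squeeze_injective hc).comp (Function.Injective.comp (fun u v huv => ?_) hf)
    by_contra hne
    have := hD.disjoint (x := .inl u) trivial (y := .inl v) trivial (by simpa using hne)
    exact Set.disjoint_singleton.1 this huv
  notMem_segment := by
    intro u v w huv hwu hwv
    have himage : segment ℝ (squeeze c (pos (f u))) (squeeze c (pos (f v))) =
        squeeze c '' segment ℝ (pos (f u)) (pos (f v)) :=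
      (image_segment ℝ (squeeze c).toAffineMap _ _).symm
    rw [himage, (squeeze_injective hc).mem_set_image]
    have hpos : ∀ x, w ≠ x → pos (f w) ≠ pos (f x) := fun x hx => by
      have := hD.disjoint (x := .inl (f w)) trivial (y := .inl (f x)) trivial
        (by simpa using hf.ne hx)
      exact Set.disjoint_singleton.1 this
    have hseg : pos (f w) ∉ openSegment ℝ (pos (f u)) (pos (f v)) := by
      have := hD.disjoint (x := .inl (f w)) trivial (y := .inr (.inl s(f u, f v))) (hG u v huv)
        (by simp)
      exact Set.disjoint_singleton_left.1 this
    rw [← insert_endpoints_openSegment]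
    rintro (h | h | h)
    exacts [hpos u hwu h, hpos v hwv h, hseg h]
  disjoint_openSegment := by
    intro u v x y huv hxy hne
    have himage : ∀ a b : ℝ × ℝ, openSegment ℝ (squeeze c a) (squeeze c b) =
        squeeze c '' openSegment ℝ a b := fun a b =>
      (image_openSegment ℝ (squeeze c).toAffineMap a b).symm
    rw [himage, himage, Set.disjoint_image_iff (squeeze_injective hc)]
    refine hD.disjoint (x := .inr (.inl s(f u, f v))) (hG u v huv)
      (y := .inr (.inl s(f x, f y))) (hG x y hxy) fun h => hne ?_
    exact Sym2.map.injective hf (by simpa using h)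

lemma localEdgeLengthRatio_le_four [Finite V] {F : Set (Sym2 W)} (hF : IsTwoTree Set.univ F)
    {f : V → W} (hf : Function.Injective f) (hG : ∀ u v, G.Adj u v → s(f u, f v) ∈ F) :
    G.localEdgeLengthRatio ≤ 4 := by
  refine le_of_forall_gt_imp_ge_of_dense fun a ha => ?_
  obtain ⟨K, hK, hKa⟩ := ENNReal.lt_iff_exists_nnreal_btwn.1 ha
  have hK4 : (4 : ℝ) < K := by exact_mod_cast hK
  obtain ⟨pos, apex, scale, hD⟩ := exists_isExtendableDrawing hK4 hF
  have hlen : ∀ u v, G.Adj u v →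
      hdist (pos (f u)) (pos (f v)) ∈ Set.Ioo (scale (f u)) ((K : ℝ) * scale (f u)) := fun u v huv =>
    (hD.isExtendable _ _ (hG u v huv)).mem_Ioo hK4
  -- Finiteness of `V` gives one `c` for all edges. Only upper bounds need the limit: squeezed
  -- lengths are never below horizontal ones.
  have hev : ∀ᶠ c in 𝓝[>] (0 : ℝ), ∀ u v, G.Adj u v →
      Dist.dist (squeeze c (pos (f u))) (squeeze c (pos (f v))) < (K : ℝ) * scale (f u) := by
    rw [eventually_all]
    intro u
    rw [eventually_all]
    intro v
    rw [eventually_all]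
    intro huv
    exact (tendsto_dist_squeeze _ _).eventually_lt_const (hlen u v huv).2
  obtain ⟨c, hc, hc0⟩ := (hev.and self_mem_nhdsWithin).exists
  refine (iInf_le _ (drawingOfExtendable hD hf hG hc0.ne')).trans (le_trans ?_ hKa.le)
  refine iSup_le fun u => iSup_le fun v => iSup_le fun w => iSup_le fun huv => iSup_le fun hvw => ?_
  rw [← ENNReal.ofReal_coe_nnreal]
  refine ENNReal.ofReal_le_ofReal ?_
  have h₁ := (hlen v w hvw).1
  have h₂ := (hlen v w hvw).2
  have h₃ := hc v u huv.symm
  have h₄ := hdist_le_dist_squeeze c (pos (f v)) (pos (f w))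
  have hs : 0 < scale (f v) := by nlinarith
  rw [_root_.dist_comm] at h₃
  show Dist.dist (squeeze c (pos (f u))) (squeeze c (pos (f v))) /
    Dist.dist (squeeze c (pos (f v))) (squeeze c (pos (f w))) ≤ K
  rw [div_le_iff₀ (by linarith)]
  nlinarith

end SimpleGraph

theorem corollary4 {V : Type*} [Finite V] (G : SimpleGraph V) :
    (G.treewidth ≤ 2 → G.localEdgeLengthRatio ≤ 4) ∧
      (G.IsSeriesParallel → G.localEdgeLengthRatio ≤ 4) := by
  constructor
  · intro h
    obtain ⟨F, hF, hG⟩ := SimpleGraph.exists_isTwoTree_of_treewidth_le_two h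
    exact SimpleGraph.localEdgeLengthRatio_le_four hF Sum.inl_injective hG
  · intro h
    obtain ⟨F, hF, hG⟩ := h.exists_isTwoTree
    exact SimpleGraph.localEdgeLengthRatio_le_four hF Function.injective_id
      fun u v huv => hG (G.mem_edgeSet.2 huv)
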